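/- Let $f,g_1,\dots,g_m\in\mathbb{R}[x]=\mathbb{R}[x_1,\dots,x_n]$, put $g_{m+i}(x)=1-x_i^2$ for $i=1,\dots,n$, and let $$K=\{x\in\mathbb{R}^n : g_j(x)\ge 0,\ j=1,\dots,m+n\}$$ (a compact subset of $[-1,1]^n$). Assume that $0\in K$ and that $K$ has nonempty interior. Let $d_0=\deg f$ and let $d\in\mathbb{N}$ satisfy $2d\ge d_0$. With $g_0=1$ and $v_j=\lceil(\deg g_j)/2\rceil$, let $$Q_d(g)=\Big\{\sum_{j=0}^{m+n}\sigma_j g_j : \sigma_j \text{ a sum of squares of polynomials},\ \deg\sigma_j\le 2(d-v_j)\Big\}$$ (with $\sigma_j=0$ if $v_j>d$). For a polynomial $p=\sum_\alpha p_\alpha x^\alpha$ let $\|p\|_1=\sum_\alpha|p_\alpha|$. Consider the inverse problem $$\mathbf{P}_d:\quad \rho_d=\min_{h}\ \{\|f-h\|_1 : h\in\mathbb{R}[x],\ \deg h\le d_0,\ h-h(0)\in Q_d(g)\}$$ and the semidefinite program $$(\ast)\quad \min_{b,\lambda\in\mathbb{R}^n}\ \Big\{\|b\|_1+\sum_{i=1}^n\lambda_i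 : f-f(0)+b'x+\sum_{i=1}^n\lambda_i x_i^2\in Q_d(g),\ \lambda\ge 0\Big\},$$ where the constraint $\lambda=0$ is added if $d_0\le 1$. Then: (i) $(\ast)$ has an optimal solution, and for every optimal solution $(b,\lambda)$ of $(\ast)$ the polynomial $$\tilde f_d(x)=f(x)+b'x+\sum_{i=1}^n\lambda_i x_i^2$$ (with $\lambda\ge 0$, and $\lambda=0$ if $d_0\le1$) is an optimal solution of $\mathbf{P}_d$, with $\rho_d=\|f-\tilde f_d\|_1=\|b\|_1+\sum_{i=1}^n\lambda_i$. In particular both minima are attained and are equal. (ii) For every optimal solution $(b,\lambda)$ of $(\ast)$ there are scalars $\theta_j\ge 0$ with $$b=-\nabla f(0)+\sum_{j\in J(0)}\theta_j\nabla g_j(0),\qquad J(0)=\{j\in\{1,\dots,m+n\} : g_j(0)=0\}.$$ -/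

import Mathlib

namespace InvPoly

open MvPolynomial

/-- `IsSos k v σ`: the polynomial `σ` is a sum of squares of degree at most `2 * (k - v)`.
The zero polynomial (of degree `-∞`) is always allowed; when `k < v` it is the only one. -/
def IsSos {n : ℕ} (k v : ℕ) (σ : MvPolynomial (Fin n) ℝ) : Prop :=
  IsSumSq σ ∧ (σ = 0 ∨ σ.totalDegree + 2 * v ≤ 2 * k)

/-- `⌈deg p / 2⌉`. -/
def halfDegree {n : ℕ} (p : MvPolynomial (Fin n) ℝ) : ℕ := (p.totalDegree + 1) / 2

/-- The truncated quadratic module `Q_k(g)`: all `σ₀ + ∑ j, σ_j * g_j` with `σ₀` a sum of squares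
of degree at most `2 k`, and `σ_j` a sum of squares of degree at most `2 (k - ⌈deg g_j / 2⌉)`. -/
def truncQuadModule {n : ℕ} {J : Type} [Fintype J] (g : J → MvPolynomial (Fin n) ℝ) (k : ℕ) :
    Set (MvPolynomial (Fin n) ℝ) :=
  {p | ∃ (σ₀ : MvPolynomial (Fin n) ℝ) (σ : J → MvPolynomial (Fin n) ℝ),
    IsSos k 0 σ₀ ∧ (∀ j, IsSos k (halfDegree (g j)) (σ j)) ∧ p = σ₀ + ∑ j, σ j * g j}

/-- The basic closed semialgebraic set `{x | g_j(x) ≥ 0 for all j}`. -/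
def semialgSet {n : ℕ} {J : Type} (g : J → MvPolynomial (Fin n) ℝ) : Set (Fin n → ℝ) :=
  {x | ∀ j, 0 ≤ eval x (g j)}

/-- The constraints `g_1, …, g_m` followed by the `n` constraints `1 - x_i ^ 2`. -/
noncomputable def withBox {n m : ℕ} (g : Fin m → MvPolynomial (Fin n) ℝ) :
    Fin m ⊕ Fin n → MvPolynomial (Fin n) ℝ :=
  Sum.elim g (fun i => 1 - X i ^ 2)

/-- The `ℓ₁`-norm of the coefficient vector. -/
noncomputable def coeffNorm {n : ℕ} (p : MvPolynomial (Fin n) ℝ) : ℝ :=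
  ∑ α ∈ p.support, |coeff α p|

/-- The gradient `∇p(0)`. -/
noncomputable def gradZero {n : ℕ} (p : MvPolynomial (Fin n) ℝ) : Fin n → ℝ :=
  fun i => eval 0 (pderiv i p)

/-- Feasible criteria of the inverse problem: polynomials `h` of degree at most `deg f`
such that `h - h(0)` belongs to `Q_d(g)`. -/
def inverseFeasible {n : ℕ} {J : Type} [Fintype J] (f : MvPolynomial (Fin n) ℝ)
    (g : J → MvPolynomial (Fin n) ℝ) (d : ℕ) : Set (MvPolynomial (Fin n) ℝ) :=
  {h | h.totalDegree ≤ f.totalDegree ∧ h - C (eval 0 h) ∈ truncQuadModule g d}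

/-- `h` is an optimal solution of the inverse problem for the `ℓ₁`-norm. -/
def IsInverseOptimal {n : ℕ} {J : Type} [Fintype J] (f : MvPolynomial (Fin n) ℝ)
    (g : J → MvPolynomial (Fin n) ℝ) (d : ℕ) (h : MvPolynomial (Fin n) ℝ) : Prop :=
  h ∈ inverseFeasible f g d ∧ ∀ h' ∈ inverseFeasible f g d, coeffNorm (f - h) ≤ coeffNorm (f - h')

/-- `b' x + ∑ i, lam_i x_i ^ 2`. -/
noncomputable def perturbation {n : ℕ} (b lam : Fin n → ℝ) : MvPolynomial (Fin n) ℝ :=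
  ∑ i, C (b i) * X i + ∑ i, C (lam i) * X i ^ 2

/-- Feasible pairs `(b, lam)` of the small semidefinite program; the variables `lam` are absent
(set to zero) unless `deg f > 1`. -/
def sdpFeasible {n : ℕ} {J : Type} [Fintype J] (f : MvPolynomial (Fin n) ℝ)
    (g : J → MvPolynomial (Fin n) ℝ) (d : ℕ) : Set ((Fin n → ℝ) × (Fin n → ℝ)) :=
  {p | (∀ i, 0 ≤ p.2 i) ∧ (f.totalDegree ≤ 1 → p.2 = 0) ∧
    f - C (eval 0 f) + perturbation p.1 p.2 ∈ truncQuadModule g d}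

/-- The objective `‖b‖₁ + ∑ i, lam_i` of the small semidefinite program. -/
def sdpCost {n : ℕ} (b lam : Fin n → ℝ) : ℝ := ∑ i, |b i| + ∑ i, lam i

/-- `(b, lam)` is an optimal solution of the small semidefinite program. -/
def IsSdpOptimal {n : ℕ} {J : Type} [Fintype J] (f : MvPolynomial (Fin n) ℝ)
    (g : J → MvPolynomial (Fin n) ℝ) (d : ℕ) (b lam : Fin n → ℝ) : Prop :=
  (b, lam) ∈ sdpFeasible f g d ∧ ∀ p ∈ sdpFeasible f g d, sdpCost b lam ≤ sdpCost p.1 p.2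

end InvPoly

/-! The key is that any `h` feasible for the inverse problem can be replaced by a feasible point of
the small program that costs no more (`exists_sdpFeasible_of_inverseFeasible`). Split `f - h` into
constant, linear and higher terms. The constant is irrelevant and `b` cancels the linear part. A
higher term `c x^α` with `2 ≤ |α| ≤ 2d` enters the module after adding squares `x_i²` of total
weight `|c|`: write `α = β + γ`, complete the square in `x^β ± x^γ`, and dominate `x^(2β)` and
`x^(2γ)` by squares of variables, using the constraints `1 - x_i²`. Conversely, an optimal `(b,
lam)` gives a feasible `f + perturbation b lam` at the same cost.

A minimizer exists because the cost dominates the norm and the feasible set is closed. The module is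
the cone over the convex hull of the compact set of normalized products `a²` and `a² g_j`. This hull
avoids zero since nonzero polynomials nonnegative on a nonempty open set cannot average to zero
(`zero_notMem_convexHull_moduleGenerators`), so the cone is closed.

The multipliers are `θ_j = σ_j(0)`, read off by differentiating a certificate at the origin, where a
vanishing sum of squares is critical. -/

/-! ### Convex hulls of compact sets and the cones over them -/

open Filter Topology in
/-- In finite dimension the convex hull of a compact set is compact. -/
theorem IsCompact.convexHull_of_finiteDimensional {E : Type*} [NormedAddCommGroup E]
    [NormedSpace ℝ E] [FiniteDimensional ℝ E] {s : Set E} (hs : IsCompact s) :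
    IsCompact (convexHull ℝ s) := by
  have key : convexHull ℝ s = ⋃ k ∈ Finset.range (Module.finrank ℝ E + 2),
      (fun p : (Fin k → ℝ) × (Fin k → E) => ∑ i, p.1 i • p.2 i) ''
        (stdSimplex ℝ (Fin k) ×ˢ Set.pi Set.univ fun _ => s) := by
    apply Set.Subset.antisymm
    · intro x hx
      obtain ⟨ι, _, z, w, hz, hind, hw, hw1, hx⟩ := eq_pos_convex_span_of_mem_convexHull hx
      -- Carathéodory: affine independence bounds the number of points by the dimension plus one, so
      -- finitely many simplices suffice.
      have hcard : Fintype.card ι ≤ Module.finrank ℝ E + 1 :=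
        hind.card_le_finrank_succ.trans (by gcongr; exact Submodule.finrank_le _)
      let e := (Fintype.equivFin ι).symm
      simp only [Set.mem_iUnion]
      refine ⟨Fintype.card ι, Finset.mem_range.2 (by omega), ⟨w ∘ e, z ∘ e⟩, ⟨⟨?_, ?_⟩, ?_⟩, ?_⟩
      · exact fun i => (hw _).le
      · simpa using (Equiv.sum_comp e w).trans hw1
      · exact fun i _ => hz ⟨_, rfl⟩
      · exact (Equiv.sum_comp e fun i => w i • z i).trans hx
    · simp only [Set.iUnion_subset_iff]
      rintro k - _ ⟨⟨w, z⟩, ⟨⟨hw, hw1⟩, hz⟩, rfl⟩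
      exact (convex_convexHull ℝ s).sum_mem (fun i _ => hw i) hw1
        fun i _ => subset_convexHull ℝ s (hz i trivial)
  rw [key]
  refine Finset.isCompact_biUnion _ fun k _ => ?_
  refine ((isCompact_stdSimplex ℝ (Fin k)).prod (isCompact_univ_pi fun _ => hs)).image ?_
  fun_prop

open Filter Topology in
/-- The cone over a compact set that avoids the origin is closed. -/
theorem IsCompact.isClosed_cone {E : Type*} [NormedAddCommGroup E] [NormedSpace ℝ E]
    {K : Set E} (hK : IsCompact K) (h0 : (0 : E) ∉ K) :
    IsClosed {x : E | ∃ t : ℝ, 0 ≤ t ∧ ∃ y ∈ K, x = t • y} := by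
  refine IsSeqClosed.isClosed fun u x hu hx => ?_
  choose t ht y hy hty using hu
  obtain ⟨z, hz, φ, hφ, hlim⟩ := hK.tendsto_subseq hy
  have hz0 : ‖z‖ ≠ 0 := norm_ne_zero_iff.2 fun h => h0 (h ▸ hz)
  have hxφ := hx.comp hφ.tendsto_atTop
  -- The scalars are ratios of norms, so they converge along with `u` and the subsequence of `y`;
  -- this needs the limit `z` to be nonzero.
  have hty' : ∀ k, t k = ‖u k‖ / ‖y k‖ := fun k => by
    have : ‖y k‖ ≠ 0 := norm_ne_zero_iff.2 fun h => h0 (h ▸ hy k)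
    rw [hty, norm_smul, Real.norm_of_nonneg (ht k), mul_div_cancel_right₀ _ this]
  have htlim : Tendsto (t ∘ φ) atTop (𝓝 (‖x‖ / ‖z‖)) := by
    refine (hxφ.norm.div hlim.norm hz0).congr fun k => ?_
    exact (hty' (φ k)).symm
  refine ⟨‖x‖ / ‖z‖, by positivity, z, hz, tendsto_nhds_unique hxφ ?_⟩
  refine (htlim.smul hlim).congr fun k => ?_
  exact (hty (φ k)).symm

/-- The cone over a convex set is closed under addition. -/
theorem Convex.add_mem_cone {E : Type*} [AddCommGroup E] [Module ℝ E] {K : Set E}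
    (hK : Convex ℝ K) {x x' : E} (hx : ∃ t : ℝ, 0 ≤ t ∧ ∃ y ∈ K, x = t • y)
    (hx' : ∃ t : ℝ, 0 ≤ t ∧ ∃ y ∈ K, x' = t • y) :
    ∃ t : ℝ, 0 ≤ t ∧ ∃ y ∈ K, x + x' = t • y := by
  obtain ⟨t, ht, y, hy, rfl⟩ := hx
  obtain ⟨t', ht', y', hy', rfl⟩ := hx'
  rcases (add_nonneg ht ht').eq_or_lt with h | h
  · obtain rfl : t = 0 := by linarith
    obtain rfl : t' = 0 := by linarith
    exact ⟨0, le_rfl, y, hy, by simp⟩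
  · refine ⟨t + t', h.le, (t / (t + t')) • y + (t' / (t + t')) • y',
      hK hy hy' (by positivity) (by positivity) (by field_simp), ?_⟩
    rw [smul_add, smul_smul, smul_smul, mul_div_cancel₀ _ h.ne', mul_div_cancel₀ _ h.ne']

/-! ### Degrees of sums of squares and the algebra of the truncated module -/

namespace InvPoly

open MvPolynomial MonomialOrder

variable {n : ℕ} {J : Type} [Fintype J]

/-- Leading terms of the same sign do not cancel. -/
theorem degLex_degree_add_of_leadingCoeff_pos {p q : MvPolynomial (Fin n) ℝ}
    (hp : 0 < degLex.leadingCoeff p) (hq : 0 ≤ degLex.leadingCoeff q)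
    (hqp : degLex.degree q ≼[degLex] degLex.degree p) :
    degLex.degree (p + q) = degLex.degree p ∧ 0 < degLex.leadingCoeff (p + q) := by
  have hc : 0 < coeff (degLex.degree p) (p + q) := by
    rw [coeff_add]
    refine add_pos_of_pos_of_nonneg hp ?_
    rcases hqp.lt_or_eq with h | h
    · rw [degLex.coeff_eq_zero_of_lt h]
    · rw [← degLex.toSyn.injective h]
      exact hq
  have hdeg : degLex.degree (p + q) = degLex.degree p := by
    refine degLex.toSyn.injective (le_antisymm ?_ ?_)
    · exact degLex.degree_add_le.trans (sup_le le_rfl hqp)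
    · exact degLex.le_degree (mem_support_iff.2 hc.ne')
  exact ⟨hdeg, by rw [MonomialOrder.leadingCoeff, hdeg]; exact hc⟩

/-- The degree-lexicographic order refines total degree, and leading coefficients of the same sign
cannot cancel. Squares have nonnegative leading coefficients, so a degree bound on a sum of squares
passes to every summand. -/
theorem totalDegree_le_add_of_leadingCoeff_nonneg {p q : MvPolynomial (Fin n) ℝ}
    (hp : 0 ≤ degLex.leadingCoeff p) (hq : 0 ≤ degLex.leadingCoeff q) :
    0 ≤ degLex.leadingCoeff (p + q) ∧ p.totalDegree ≤ (p + q).totalDegree ∧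
      q.totalDegree ≤ (p + q).totalDegree := by
  rcases hp.eq_or_lt with h | hp'
  · obtain rfl := (degLex.leadingCoeff_eq_zero_iff).1 h.symm
    simp [hq]
  rcases hq.eq_or_lt with h | hq'
  · obtain rfl := (degLex.leadingCoeff_eq_zero_iff).1 h.symm
    simp [hp]
  rcases le_total (degLex.toSyn (degLex.degree q)) (degLex.toSyn (degLex.degree p)) with h | h
  · obtain ⟨h1, h2⟩ := degLex_degree_add_of_leadingCoeff_pos hp' hq h
    refine ⟨h2.le, degLex_totalDegree_monotone (by rw [h1]),
      degLex_totalDegree_monotone (by rw [h1]; exact h)⟩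
  · obtain ⟨h1, h2⟩ := degLex_degree_add_of_leadingCoeff_pos hq' hp h
    rw [add_comm p q]
    refine ⟨h2.le, degLex_totalDegree_monotone (by rw [h1]; exact h),
      degLex_totalDegree_monotone (by rw [h1])⟩

theorem leadingCoeff_mul_self_nonneg (a : MvPolynomial (Fin n) ℝ) :
    0 ≤ degLex.leadingCoeff (a * a) := by
  rw [degLex.leadingCoeff_mul]
  exact mul_self_nonneg _

theorem leadingCoeff_nonneg_of_isSumSq {s : MvPolynomial (Fin n) ℝ} (hs : IsSumSq s) :
    0 ≤ degLex.leadingCoeff s := by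
  induction hs with
  | zero => simp
  | sq_add a _ ih =>
    exact (totalDegree_le_add_of_leadingCoeff_nonneg (leadingCoeff_mul_self_nonneg a) ih).1

theorem totalDegree_mul_self (a : MvPolynomial (Fin n) ℝ) :
    (a * a).totalDegree = 2 * a.totalDegree := by
  by_cases ha : a = 0
  · simp [ha]
  · rw [totalDegree_mul_of_isDomain ha ha, two_mul]

/-- A sum of squares of degree at most `2 k` is a sum of squares of polynomials of degree at most
`k`. -/
theorem IsSumSq.mem_of_totalDegree_le {s : MvPolynomial (Fin n) ℝ} (hs : IsSumSq s) {k : ℕ}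
    (hk : s.totalDegree ≤ 2 * k) (M : AddSubmonoid (MvPolynomial (Fin n) ℝ))
    (hM : ∀ a : MvPolynomial (Fin n) ℝ, a.totalDegree ≤ k → a * a ∈ M) : s ∈ M := by
  induction hs with
  | zero => exact M.zero_mem
  | sq_add a hs ih =>
    obtain ⟨-, h1, h2⟩ := totalDegree_le_add_of_leadingCoeff_nonneg
      (leadingCoeff_mul_self_nonneg a) (leadingCoeff_nonneg_of_isSumSq hs)
    rw [totalDegree_mul_self] at h1
    exact M.add_mem (hM a (by omega)) (ih (h2.trans hk))

theorem isSumSq_smul {s : MvPolynomial (Fin n) ℝ} (hs : IsSumSq s) {c : ℝ} (hc : 0 ≤ c) :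
    IsSumSq (c • s) := by
  rw [smul_eq_C_mul, ← Real.mul_self_sqrt hc, C_mul]
  exact (IsSumSq.mul_self _).mul hs

theorem IsSos.zero (k v : ℕ) : IsSos k v (0 : MvPolynomial (Fin n) ℝ) := ⟨.zero, .inl rfl⟩

theorem IsSos.add {k v : ℕ} {s t : MvPolynomial (Fin n) ℝ} (hs : IsSos k v s)
    (ht : IsSos k v t) : IsSos k v (s + t) := by
  refine ⟨hs.1.add ht.1, ?_⟩
  rcases hs.2 with rfl | h1
  · simpa using ht.2
  rcases ht.2 with rfl | h2
  · simpa using Or.inr h1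
  · have := totalDegree_add s t
    right
    omega

theorem IsSos.smul {k v : ℕ} {s : MvPolynomial (Fin n) ℝ} (hs : IsSos k v s) {c : ℝ}
    (hc : 0 ≤ c) : IsSos k v (c • s) := by
  refine ⟨isSumSq_smul hs.1 hc, ?_⟩
  rcases hs.2 with rfl | h1
  · simp
  · have := totalDegree_smul_le c s
    right
    omega

theorem IsSos.mul_self {k v : ℕ} {a : MvPolynomial (Fin n) ℝ} (ha : a.totalDegree + v ≤ k) :
    IsSos k v (a * a) :=
  ⟨.mul_self a, .inr (by rw [totalDegree_mul_self]; omega)⟩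

/-- Reduces claims about sum-of-squares multipliers to single squares of bounded degree, which is
how finite-dimensional generators become available. -/
theorem IsSos.mul_mem {k v : ℕ} {s : MvPolynomial (Fin n) ℝ} (hs : IsSos k v s)
    (g : MvPolynomial (Fin n) ℝ) (M : AddSubmonoid (MvPolynomial (Fin n) ℝ))
    (hM : ∀ a : MvPolynomial (Fin n) ℝ, a.totalDegree + v ≤ k → a * a * g ∈ M) : s * g ∈ M := by
  rcases hs.2 with rfl | h
  · simp
  · exact IsSumSq.mem_of_totalDegree_le hs.1 (k := k - v) (by omega)
      (M.comap (AddMonoidHom.mulRight g)) fun a ha => hM a (by omega)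

variable {g : J → MvPolynomial (Fin n) ℝ} {k : ℕ} {p q : MvPolynomial (Fin n) ℝ}

theorem zero_mem_truncQuadModule : 0 ∈ truncQuadModule g k :=
  ⟨0, 0, .zero _ _, fun _ => .zero _ _, by simp⟩

theorem add_mem_truncQuadModule (hp : p ∈ truncQuadModule g k) (hq : q ∈ truncQuadModule g k) :
    p + q ∈ truncQuadModule g k := by
  obtain ⟨s, σ, hs, hσ, rfl⟩ := hp
  obtain ⟨t, τ, ht, hτ, rfl⟩ := hq
  refine ⟨s + t, σ + τ, hs.add ht, fun j => (hσ j).add (hτ j), ?_⟩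
  simp only [Pi.add_apply, add_mul, Finset.sum_add_distrib]
  ring

theorem smul_mem_truncQuadModule (hp : p ∈ truncQuadModule g k) {c : ℝ} (hc : 0 ≤ c) :
    c • p ∈ truncQuadModule g k := by
  obtain ⟨s, σ, hs, hσ, rfl⟩ := hp
  refine ⟨c • s, c • σ, hs.smul hc, fun j => (hσ j).smul hc, ?_⟩
  simp [smul_add, Finset.smul_sum]

theorem mul_self_mem_truncQuadModule {a : MvPolynomial (Fin n) ℝ} (ha : a.totalDegree ≤ k) :
    a * a ∈ truncQuadModule g k :=
  ⟨a * a, 0, .mul_self ha, fun _ => .zero _ _, by simp⟩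

theorem mul_self_mul_mem_truncQuadModule {a : MvPolynomial (Fin n) ℝ} (j : J)
    (ha : a.totalDegree + halfDegree (g j) ≤ k) : a * a * g j ∈ truncQuadModule g k := by
  classical
  refine ⟨0, Pi.single j (a * a), .zero _ _, fun i => ?_, ?_⟩
  · rcases eq_or_ne i j with rfl | h
    · simpa using IsSos.mul_self ha
    · simpa [h] using IsSos.zero _ _
  · rw [zero_add, Finset.sum_eq_single j] <;> simp +contextual

/-- The truncated quadratic module is generated, as an additive monoid, by the products `a² g_j`. -/
theorem truncQuadModule_subset (M : AddSubmonoid (MvPolynomial (Fin n) ℝ))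
    (h0 : ∀ a : MvPolynomial (Fin n) ℝ, a.totalDegree ≤ k → a * a ∈ M)
    (h1 : ∀ j, ∀ a : MvPolynomial (Fin n) ℝ, a.totalDegree + halfDegree (g j) ≤ k →
      a * a * g j ∈ M) : truncQuadModule g k ⊆ M := by
  rintro _ ⟨s, σ, hs, hσ, rfl⟩
  refine M.add_mem ?_ (M.sum_mem fun j _ => (hσ j).mul_mem _ M (h1 j))
  simpa using hs.mul_mem 1 M fun a ha => by simpa using h0 a ha

end InvPoly

/-! ### Closedness of the truncated module in coefficient space -/

namespace InvPoly

open MvPolynomial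

variable {n : ℕ} {J : Type}

/-- The exponents of degree at most `k`. -/
noncomputable def exponents (n k : ℕ) : Finset (Fin n →₀ ℕ) :=
  (Finsupp.finite_of_degree_le (σ := Fin n) k).toFinset

theorem mem_exponents {k : ℕ} {α : Fin n →₀ ℕ} : α ∈ exponents n k ↔ α.degree ≤ k := by
  simp [exponents]

/-- The coefficients of degree at most `k`. -/
noncomputable def coeffMap (n k : ℕ) : MvPolynomial (Fin n) ℝ →ₗ[ℝ] (exponents n k → ℝ) where
  toFun p α := coeff α.1 p
  map_add' p q := by ext; simp
  map_smul' c p := by ext; simp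

@[simp] theorem coeffMap_apply (k : ℕ) (p : MvPolynomial (Fin n) ℝ) (α : exponents n k) :
    coeffMap n k p α = coeff α.1 p := rfl

/-- The polynomial of degree at most `k` with given coefficients. -/
noncomputable def polyOf (n k : ℕ) (c : exponents n k → ℝ) : MvPolynomial (Fin n) ℝ :=
  ∑ α, c α • monomial α.1 (1 : ℝ)

theorem degree_le_totalDegree {p : MvPolynomial (Fin n) ℝ} {α : Fin n →₀ ℕ}
    (h : α ∈ p.support) : α.degree ≤ p.totalDegree := le_totalDegree h

theorem coeffMap_injOn {k : ℕ} {p q : MvPolynomial (Fin n) ℝ} (hp : p.totalDegree ≤ k)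
    (hq : q.totalDegree ≤ k) (h : coeffMap n k p = coeffMap n k q) : p = q := by
  ext α
  by_cases hα : α ∈ exponents n k
  · exact congrFun h ⟨α, hα⟩
  · rw [mem_exponents, not_le] at hα
    rw [notMem_support_iff.1 fun h => absurd (degree_le_totalDegree h) (by omega),
      notMem_support_iff.1 fun h => absurd (degree_le_totalDegree h) (by omega)]

theorem totalDegree_polyOf (k : ℕ) (c : exponents n k → ℝ) : (polyOf n k c).totalDegree ≤ k := by
  refine totalDegree_finsetSum_le fun α _ => ?_
  refine (totalDegree_smul_le _ _).trans ((totalDegree_monomial_le _ _).trans ?_)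
  exact mem_exponents.1 α.2

theorem coeffMap_polyOf (k : ℕ) (c : exponents n k → ℝ) : coeffMap n k (polyOf n k c) = c := by
  classical
  ext α
  simp [polyOf, coeff_sum, coeff_monomial]

theorem polyOf_coeffMap {k : ℕ} {p : MvPolynomial (Fin n) ℝ} (hp : p.totalDegree ≤ k) :
    polyOf n k (coeffMap n k p) = p :=
  coeffMap_injOn (totalDegree_polyOf _ _) hp (coeffMap_polyOf _ _)

theorem polyOf_smul (k : ℕ) (t : ℝ) (c : exponents n k → ℝ) :
    polyOf n k (t • c) = t • polyOf n k c := by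
  simp [polyOf, Finset.smul_sum, mul_smul]

/-- The coefficient vectors of the products `a² q`, where `a` has degree at most `k` and a
coefficient vector of norm one. -/
noncomputable def squareGenerators (q : MvPolynomial (Fin n) ℝ) (k N : ℕ) :
    Set (exponents n N → ℝ) :=
  (fun c => coeffMap n N (polyOf n k c * polyOf n k c * q)) '' Metric.sphere 0 1

theorem isCompact_squareGenerators (q : MvPolynomial (Fin n) ℝ) (k N : ℕ) :
    IsCompact (squareGenerators q k N) := by
  refine (isCompact_sphere 0 1).image (continuous_pi fun β => ?_)
  simp only [coeffMap_apply, polyOf, Finset.sum_mul, Finset.mul_sum, coeff_sum, smul_mul_assoc,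
    mul_smul_comm, coeff_smul]
  fun_prop

theorem mul_self_mul_eq_smul {q a : MvPolynomial (Fin n) ℝ} {k N : ℕ} (ha : a.totalDegree ≤ k)
    (ha0 : a ≠ 0) : ∃ t : ℝ, 0 ≤ t ∧ ∃ y ∈ squareGenerators q k N,
      coeffMap n N (a * a * q) = t • y := by
  set c := coeffMap n k a with hc
  have hac : polyOf n k c = a := polyOf_coeffMap ha
  have hc0 : ‖c‖ ≠ 0 := norm_ne_zero_iff.2 fun h => ha0 <| by
    rw [← hac, h]; simp [polyOf]
  -- Products `a² q` are quadratic in the coefficients of `a`, so normalizing the vector costs a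
  -- factor `‖c‖²`.
  refine ⟨‖c‖ * ‖c‖, by positivity, _, ⟨‖c‖⁻¹ • c, ?_, rfl⟩, ?_⟩
  · rw [mem_sphere_zero_iff_norm, norm_smul, norm_inv, norm_norm, inv_mul_cancel₀ hc0]
  · simp only
    rw [← map_smul, polyOf_smul, hac]
    congr 1
    simp only [smul_mul_assoc, mul_smul_comm, smul_smul]
    rw [show ‖c‖ * ‖c‖ * (‖c‖⁻¹ * ‖c‖⁻¹) = 1 by field_simp, one_smul]

/-- The coefficient vectors of the normalized generators of the truncated quadratic module. -/
noncomputable def moduleGenerators (g : J → MvPolynomial (Fin n) ℝ) (k N : ℕ) :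
    Set (exponents n N → ℝ) :=
  squareGenerators 1 k N ∪
    ⋃ j ∈ {j | g j ≠ 0 ∧ halfDegree (g j) ≤ k}, squareGenerators (g j) (k - halfDegree (g j)) N

theorem isCompact_moduleGenerators [Fintype J] (g : J → MvPolynomial (Fin n) ℝ)
    (k N : ℕ) :
    IsCompact (moduleGenerators g k N) :=
  (isCompact_squareGenerators _ _ _).union <|
    (Set.toFinite _).isCompact_biUnion fun _ _ => isCompact_squareGenerators _ _ _

theorem moduleGenerators_nonempty (g : J → MvPolynomial (Fin n) ℝ) (k N : ℕ) :
    (moduleGenerators g k N).Nonempty := by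
  obtain ⟨_, _, y, hy, _⟩ := mul_self_mul_eq_smul (n := n) (q := 1) (a := 1) (k := k) (N := N)
    (by simp) one_ne_zero
  exact ⟨y, .inl hy⟩

/-- A polynomial vanishing on a nonempty open set is zero. -/
theorem eq_zero_of_isOpen {U : Set (Fin n → ℝ)} (hU : IsOpen U) (hne : U.Nonempty)
    {p : MvPolynomial (Fin n) ℝ} (h : ∀ x ∈ U, eval x p = 0) : p = 0 := by
  obtain ⟨x, hx⟩ := hne
  obtain ⟨ε, hε, hball⟩ := Metric.isOpen_iff.1 hU x hx
  refine funext_set (fun i => Metric.ball (x i) ε) (fun i => ?_) fun y hy => ?_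
  · rw [Real.ball_eq_Ioo]
    exact Set.Ioo_infinite (by linarith)
  · rw [map_zero]
    exact h y (hball (by rw [ball_pi x hε]; exact hy))

/-- Nonzero polynomials of degree at most `N` that are nonnegative on the interior form a convex set
containing every generator. If a convex combination of two of them were zero, both terms would
vanish on a nonempty open set, hence identically, forcing both weights to be zero. -/
theorem zero_notMem_convexHull_moduleGenerators (g : J → MvPolynomial (Fin n) ℝ) (k N : ℕ)
    (hN : 2 * k ≤ N) (hint : (interior (semialgSet g)).Nonempty) :
    (0 : exponents n N → ℝ) ∉ convexHull ℝ (moduleGenerators g k N) := by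
  set P : Set (MvPolynomial (Fin n) ℝ) :=
    {p | p.totalDegree ≤ N ∧ p ≠ 0 ∧ ∀ x ∈ interior (semialgSet g), 0 ≤ eval x p} with hP
  have hconv : Convex ℝ P := by
    rintro p ⟨hp, hp0, hpx⟩ q ⟨hq, hq0, hqx⟩ a b ha hb hab
    refine ⟨(totalDegree_add _ _).trans (max_le ((totalDegree_smul_le _ _).trans hp)
      ((totalDegree_smul_le _ _).trans hq)), fun h => ?_, fun x hx => ?_⟩
    · have key : ∀ x ∈ interior (semialgSet g), eval x (a • p) = 0 ∧ eval x (b • q) = 0 := by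
        intro x hx
        have := congrArg (eval x) h
        simp only [map_add, smul_eval, map_zero] at this ⊢
        have h1 := mul_nonneg ha (hpx x hx)
        have h2 := mul_nonneg hb (hqx x hx)
        constructor <;> linarith
      have h1 := eq_zero_of_isOpen isOpen_interior hint fun x hx => (key x hx).1
      have h2 := eq_zero_of_isOpen isOpen_interior hint fun x hx => (key x hx).2
      have h1 := (smul_eq_zero.1 h1).resolve_right hp0
      have h2 := (smul_eq_zero.1 h2).resolve_right hq0
      linarith
    · simp only [map_add, smul_eval]
      exact add_nonneg (mul_nonneg ha (hpx x hx)) (mul_nonneg hb (hqx x hx))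
  have hsub : ∀ (q : MvPolynomial (Fin n) ℝ) (l : ℕ), q ≠ 0 → 2 * l + q.totalDegree ≤ N →
      (∀ x ∈ interior (semialgSet g), 0 ≤ eval x q) →
      squareGenerators q l N ⊆ coeffMap n N '' P := by
    rintro q l hq hl hx _ ⟨c, hc, rfl⟩
    refine ⟨_, ⟨?_, ?_, fun x hxU => ?_⟩, rfl⟩
    · have h1 := totalDegree_mul (polyOf n l c * polyOf n l c) q
      rw [totalDegree_mul_self] at h1
      have := totalDegree_polyOf l c
      omega
    · have : polyOf n l c ≠ 0 := fun h => by
        have h2 := coeffMap_polyOf l c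
        rw [h, map_zero] at h2
        rw [← h2] at hc
        simp at hc
      exact mul_ne_zero (mul_ne_zero this this) hq
    · rw [map_mul, map_mul]
      exact mul_nonneg (mul_self_nonneg _) (hx x hxU)
  have hgen : moduleGenerators g k N ⊆ coeffMap n N '' P := by
    refine Set.union_subset (hsub 1 k one_ne_zero (by simpa using hN) (by simp)) ?_
    refine Set.iUnion₂_subset fun j hj => hsub _ _ hj.1 ?_ fun x hx => interior_subset hx j
    have := hj.2
    rw [halfDegree] at *
    omega
  intro h0
  obtain ⟨p, ⟨hp, hp0, -⟩, h⟩ := convexHull_min hgen (hconv.linear_image _) h0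
  exact hp0 (coeffMap_injOn hp (by simp) (by rw [h, map_zero]))

theorem totalDegree_le_of_mem_truncQuadModule [Fintype J] {g : J → MvPolynomial (Fin n) ℝ}
    {k : ℕ} {p : MvPolynomial (Fin n) ℝ} (hp : p ∈ truncQuadModule g k) : p.totalDegree ≤ 2 * k := by
  rw [← mem_restrictTotalDegree]
  refine truncQuadModule_subset (restrictTotalDegree (Fin n) ℝ (2 * k)).toAddSubmonoid
    (fun a ha => ?_) (fun j a ha => ?_) hp
  · simp only [Submodule.mem_toAddSubmonoid, mem_restrictTotalDegree]
    rw [totalDegree_mul_self]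
    omega
  · simp only [Submodule.mem_toAddSubmonoid, mem_restrictTotalDegree]
    refine (totalDegree_mul _ _).trans ?_
    rw [totalDegree_mul_self]
    rw [halfDegree] at ha
    omega

/-- Membership in the truncated quadratic module, in terms of coefficient vectors. -/
theorem mem_truncQuadModule_iff [Fintype J] {g : J → MvPolynomial (Fin n) ℝ} {k N : ℕ}
    (hN : 2 * k ≤ N) {p : MvPolynomial (Fin n) ℝ} (hp : p.totalDegree ≤ N) :
    p ∈ truncQuadModule g k ↔ coeffMap n N p ∈
      {x | ∃ t : ℝ, 0 ≤ t ∧ ∃ y ∈ convexHull ℝ (moduleGenerators g k N), x = t • y} := by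
  set T := {x | ∃ t : ℝ, 0 ≤ t ∧ ∃ y ∈ convexHull ℝ (moduleGenerators g k N), x = t • y} with hT
  constructor
  · intro h
    have h0 : (0 : exponents n N → ℝ) ∈ T := by
      obtain ⟨y, hy⟩ := moduleGenerators_nonempty g k N
      exact ⟨0, le_rfl, y, subset_convexHull ℝ _ hy, by simp⟩
    let M : AddSubmonoid (exponents n N → ℝ) :=
      { carrier := T
        zero_mem' := h0
        add_mem' := (convex_convexHull ℝ _).add_mem_cone }
    refine truncQuadModule_subset (M.comap (coeffMap n N)) (fun a ha => ?_) (fun j a ha => ?_) h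
    · change coeffMap n N (a * a) ∈ T
      rcases eq_or_ne a 0 with rfl | ha0
      · simpa using h0
      · obtain ⟨t, ht, y, hy, h⟩ := mul_self_mul_eq_smul (q := 1) (N := N) ha ha0
        exact ⟨t, ht, y, subset_convexHull ℝ _ (.inl hy), by rw [← h, mul_one]⟩
    · change coeffMap n N (a * a * g j) ∈ T
      rcases eq_or_ne a 0 with rfl | ha0
      · simpa using h0
      -- Zero constraints are excluded from the generators, since they would put the origin in the
      -- hull.
      rcases eq_or_ne (g j) 0 with hg0 | hg0
      · simpa [hg0] using h0
      obtain ⟨t, ht, y, hy, h⟩ := mul_self_mul_eq_smul (q := g j) (N := N)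
        (k := k - halfDegree (g j)) (by omega) ha0
      refine ⟨t, ht, y, subset_convexHull ℝ _ (.inr ?_), h⟩
      exact Set.mem_biUnion (show j ∈ {j | g j ≠ 0 ∧ halfDegree (g j) ≤ k} from
        ⟨hg0, by omega⟩) hy
  · rintro ⟨t, ht, y, hy, h⟩
    have hconv : Convex ℝ (truncQuadModule g k) := fun p hp q hq a b ha hb _ =>
      add_mem_truncQuadModule (smul_mem_truncQuadModule hp ha) (smul_mem_truncQuadModule hq hb)
    have hgen : moduleGenerators g k N ⊆ coeffMap n N '' truncQuadModule g k := by
      refine Set.union_subset ?_ (Set.iUnion₂_subset fun j hj => ?_)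
      · rintro _ ⟨c, -, rfl⟩
        exact ⟨_, mul_self_mem_truncQuadModule (totalDegree_polyOf k c), by simp⟩
      · rintro _ ⟨c, -, rfl⟩
        refine ⟨_, mul_self_mul_mem_truncQuadModule j ?_, rfl⟩
        have := totalDegree_polyOf (n := n) _ c
        have := hj.2
        omega
    obtain ⟨q, hq, rfl⟩ := convexHull_min hgen (hconv.linear_image _) hy
    have hq' := smul_mem_truncQuadModule hq ht
    rw [← map_smul] at h
    rwa [coeffMap_injOn hp ((totalDegree_le_of_mem_truncQuadModule hq').trans hN) h]

/-- If `{g ≥ 0}` has nonempty interior, then the coefficient vectors of the truncated quadratic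
module form a closed cone. -/
theorem isClosed_coeff_truncQuadModule [Fintype J] (g : J → MvPolynomial (Fin n) ℝ)
    {k N : ℕ} (hN : 2 * k ≤ N) (hint : (interior (semialgSet g)).Nonempty) :
    IsClosed {x | ∃ t : ℝ, 0 ≤ t ∧
      ∃ y ∈ convexHull ℝ (moduleGenerators g k N), x = t • y} :=
  (isCompact_moduleGenerators g k N).convexHull_of_finiteDimensional.isClosed_cone
    (zero_notMem_convexHull_moduleGenerators g k N hN hint)

end InvPoly

/-! ### Absorbing higher-degree terms through the box constraints -/

namespace InvPoly

open MvPolynomial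

variable {n m : ℕ} {g : Fin m → MvPolynomial (Fin n) ℝ} {d : ℕ}

theorem halfDegree_one_sub_X_sq_le (i : Fin n) :
    halfDegree (1 - X i ^ 2 : MvPolynomial (Fin n) ℝ) ≤ 1 := by
  have h : (1 - X i ^ 2 : MvPolynomial (Fin n) ℝ).totalDegree ≤ 2 :=
    (totalDegree_sub _ _).trans (by simp [totalDegree_X_pow])
  rw [halfDegree]
  omega

theorem mul_self_mul_one_sub_X_sq_mem (i : Fin n) {a : MvPolynomial (Fin n) ℝ}
    (ha : a.totalDegree + 1 ≤ d) : a * a * (1 - X i ^ 2) ∈ truncQuadModule (withBox g) d :=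
  mul_self_mul_mem_truncQuadModule (g := withBox g) (.inr i)
    (by have := halfDegree_one_sub_X_sq_le i; simp only [withBox, Sum.elim_inr]; omega)

theorem exists_eq_add_single {α : Fin n →₀ ℕ} {k : ℕ} (h : α.degree = k + 1) :
    ∃ β i, α = β + Finsupp.single i 1 ∧ β.degree = k := by
  obtain ⟨i, hi⟩ : ∃ i, α i ≠ 0 := by
    by_contra! h'
    obtain rfl : α = 0 := by ext i; exact h' i
    simp at h
  have hle : Finsupp.single i 1 ≤ α := by
    simpa [Finsupp.single_le_iff] using Nat.one_le_iff_ne_zero.2 hi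
  have he : α = α - Finsupp.single i 1 + Finsupp.single i 1 := (tsub_add_cancel_of_le hle).symm
  refine ⟨α - Finsupp.single i 1, i, he, ?_⟩
  rw [he, map_add, Finsupp.degree_single] at h
  omega

/-- On the box, squaring and multiplying by a monomial decreases, with a bounded certificate. -/
theorem mul_self_sub_mem_truncQuadModule (a : MvPolynomial (Fin n) ℝ) (δ : Fin n →₀ ℕ)
    (h : a.totalDegree + δ.degree ≤ d) :
    a * a - (a * monomial δ 1) * (a * monomial δ 1) ∈ truncQuadModule (withBox g) d := by
  induction hk : δ.degree generalizing δ with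
  | zero =>
    rw [Finsupp.degree_eq_zero_iff] at hk
    subst hk
    simpa using zero_mem_truncQuadModule
  | succ k ih =>
    obtain ⟨β, i, rfl, hβ⟩ := exists_eq_add_single hk
    have h1 := ih β (by omega) hβ
    have hdeg : (a * monomial β (1 : ℝ)).totalDegree + 1 ≤ d := by
      have h2 := totalDegree_mul a (monomial β (1 : ℝ))
      have h3 : (monomial β (1 : ℝ)).totalDegree ≤ β.degree := totalDegree_monomial_le β 1
      omega
    -- Telescoping: the new term is `(a x^β)² - (a x^β x_i)² = (a x^β)² (1 - x_i²)`.
    convert add_mem_truncQuadModule h1 (mul_self_mul_one_sub_X_sq_mem i hdeg) using 1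
    rw [show (monomial (β + Finsupp.single i 1) (1 : ℝ)) = monomial β 1 * X i by
      rw [X, monomial_mul, one_mul]]
    ring

/-- Keep one variable `x_i` dividing `x^β` and remove the remaining factors by the telescoping
bound, with `a = x_i`. -/
theorem exists_X_sq_sub_mem_truncQuadModule {β : Fin n →₀ ℕ} (h1 : 1 ≤ β.degree)
    (hd : β.degree ≤ d) : ∃ i, X i ^ 2 - monomial β 1 * monomial β 1 ∈
      truncQuadModule (withBox g) d := by
  obtain ⟨k, hk⟩ := Nat.exists_eq_add_of_le' h1
  obtain ⟨γ, i, rfl, hγ⟩ := exists_eq_add_single hk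
  refine ⟨i, ?_⟩
  convert mul_self_sub_mem_truncQuadModule (g := g) (d := d) (X i) γ (by
    rw [totalDegree_X]; omega) using 1
  rw [show (monomial (γ + Finsupp.single i 1) (1 : ℝ)) = X i * monomial γ 1 by
    rw [X, monomial_mul, one_mul, add_comm]]
  ring

/-- A term of degree between `2` and `2 d` is compensated by a quadratic perturbation whose weight
is the absolute value of the coefficient. -/
theorem exists_monomial_add_mem_truncQuadModule {α : Fin n →₀ ℕ} (h2 : 2 ≤ α.degree)
    (hd : α.degree ≤ 2 * d) (c : ℝ) : ∃ μ : Fin n → ℝ, (∀ i, 0 ≤ μ i) ∧ ∑ i, μ i = |c| ∧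
      monomial α c + ∑ i, C (μ i) * X i ^ 2 ∈ truncQuadModule (withBox g) d := by
  -- Halving the degree leaves both `β` and `γ` with degree between `1` and `d`, as the two
  -- domination certificates require.
  obtain ⟨β, hβ, hβd⟩ := Finsupp.exists_le_degree_eq α (α.degree / 2) (by omega)
  obtain ⟨γ, rfl⟩ := exists_add_of_le hβ
  rw [map_add] at *
  obtain ⟨i, hi⟩ := exists_X_sq_sub_mem_truncQuadModule (g := g) (d := d) (β := β)
    (by omega) (by omega)
  obtain ⟨j, hj⟩ := exists_X_sq_sub_mem_truncQuadModule (g := g) (d := d) (β := γ)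
    (by omega) (by omega)
  obtain ⟨s, hs, hsc⟩ : ∃ s : ℝ, s * s = 1 ∧ |c| * s = c := by
    rcases le_total 0 c with h | h
    · exact ⟨1, by norm_num, by simp [abs_of_nonneg h]⟩
    · exact ⟨-1, by norm_num, by simp [abs_of_nonpos h]⟩
  have hsq : (monomial β 1 + C s * monomial γ 1) * (monomial β 1 + C s * monomial γ 1) ∈
      truncQuadModule (withBox g) d := by
    refine mul_self_mem_truncQuadModule ((totalDegree_add _ _).trans (max_le ?_ ?_))
    · exact (totalDegree_monomial_le β _).trans (show β.degree ≤ d by omega)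
    · rw [C_mul_monomial]
      exact (totalDegree_monomial_le γ _).trans (show γ.degree ≤ d by omega)
  have hc : 0 ≤ |c| / 2 := by positivity
  refine ⟨fun l => (if l = i then |c| / 2 else 0) + if l = j then |c| / 2 else 0,
    fun l => ?_, ?_, ?_⟩
  · dsimp only
    split_ifs <;> linarith
  · rw [Finset.sum_add_distrib]
    simp
  -- With `s` a sign of `c`, `(|c|/2) [(x^β + s x^γ)² + (x_i² - x^(2β)) + (x_j² - x^(2γ))]` equals
  -- `c x^α + (|c|/2)(x_i² + x_j²)`. The additive form of the weights covers `i = j`.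
  · convert smul_mem_truncQuadModule
      (add_mem_truncQuadModule hsq (add_mem_truncQuadModule hi hj)) hc using 1
    have h1 : ∑ l, C ((if l = i then |c| / 2 else 0) + if l = j then |c| / 2 else 0) * X l ^ 2 =
        C (|c| / 2) * (X i ^ 2 + X j ^ 2 : MvPolynomial (Fin n) ℝ) := by
      simp only [C_add, add_mul, Finset.sum_add_distrib, apply_ite C, C_0, ite_mul, zero_mul,
        Finset.sum_ite_eq', Finset.mem_univ, if_true]
      ring
    have h2 : monomial (β + γ) c = C (|c| / 2) * (2 * C s * monomial β 1 * monomial γ 1) := by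
      have h3 : monomial (β + γ) c = C c * (monomial β 1 * monomial γ 1) := by
        rw [monomial_mul, C_mul_monomial]; simp
      have h4 : (C c : MvPolynomial (Fin n) ℝ) = C (|c| / 2) * 2 * C s := by
        rw [show (2 : MvPolynomial (Fin n) ℝ) = C 2 from (map_ofNat C 2).symm, ← C_mul, ← C_mul,
          div_mul_cancel₀ _ two_ne_zero, hsc]
      rw [h3, h4]
      ring
    have h5 : (C s * C s : MvPolynomial (Fin n) ℝ) = 1 := by rw [← C_mul, hs, C_1]
    rw [h1, h2, smul_eq_C_mul]
    linear_combination (-C (|c| / 2) * monomial γ 1 * monomial γ 1) * h5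

theorem exists_sum_monomial_add_mem_truncQuadModule (s : Finset (Fin n →₀ ℕ))
    (h2 : ∀ α ∈ s, 2 ≤ α.degree) (hd : ∀ α ∈ s, α.degree ≤ 2 * d) (c : (Fin n →₀ ℕ) → ℝ) :
    ∃ μ : Fin n → ℝ, (∀ i, 0 ≤ μ i) ∧ ∑ i, μ i = ∑ α ∈ s, |c α| ∧
      ∑ α ∈ s, monomial α (c α) + ∑ i, C (μ i) * X i ^ 2 ∈ truncQuadModule (withBox g) d := by
  induction s using Finset.induction_on with
  | empty => exact ⟨0, by simp, by simp, by simpa using zero_mem_truncQuadModule⟩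
  | insert α s hα ih =>
    obtain ⟨μ, h0, h1, h2'⟩ := ih (fun β hβ => h2 β (Finset.mem_insert_of_mem hβ))
      (fun β hβ => hd β (Finset.mem_insert_of_mem hβ))
    obtain ⟨ν, k0, k1, k2⟩ := exists_monomial_add_mem_truncQuadModule (g := g)
      (h2 α (Finset.mem_insert_self _ _)) (hd α (Finset.mem_insert_self _ _)) (c α)
    refine ⟨fun i => ν i + μ i, fun i => add_nonneg (k0 i) (h0 i), ?_, ?_⟩
    · rw [Finset.sum_add_distrib, h1, k1, Finset.sum_insert hα]
    · convert add_mem_truncQuadModule k2 h2' using 1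
      simp only [Finset.sum_insert hα, C_add, add_mul, Finset.sum_add_distrib]
      ring

theorem exists_eq_single_of_degree_eq_one {α : Fin n →₀ ℕ} (h : α.degree = 1) :
    ∃ i, α = Finsupp.single i 1 := by
  obtain ⟨β, i, rfl, hβ⟩ := exists_eq_add_single (k := 0) h
  rw [Finsupp.degree_eq_zero_iff] at hβ
  exact ⟨i, by rw [hβ, zero_add]⟩

theorem eq_constant_add_linear_add_higher (q : MvPolynomial (Fin n) ℝ) :
    q = C (eval 0 q) + ∑ i, C (coeff (Finsupp.single i 1) q) * X i +
      ∑ α ∈ q.support with 2 ≤ α.degree, monomial α (coeff α q) := by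
  classical
  have hX : ∀ i : Fin n, ∀ c : ℝ, C c * X i = monomial (Finsupp.single i 1) c := fun i c => by
    rw [X, C_mul_monomial, mul_one]
  ext β
  have h0 : eval 0 q = coeff 0 q := by rw [eval_zero, constantCoeff_eq]
  simp only [hX, coeff_add, coeff_sum, coeff_C, coeff_monomial, h0, Finset.sum_ite_eq',
    Finset.mem_filter, mem_support_iff]
  have hs : ∀ i : Fin n, (Finsupp.single i 1 : Fin n →₀ ℕ).degree = 1 := fun i => by simp
  rcases hβ : β.degree with _ | _ | k
  · rw [Finsupp.degree_eq_zero_iff] at hβ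
    subst hβ
    rw [Finset.sum_eq_zero]
    · simp
    · intro i _
      rw [if_neg]
      simp
  · obtain ⟨i, rfl⟩ := exists_eq_single_of_degree_eq_one hβ
    have h01 : (0 : Fin n →₀ ℕ) ≠ Finsupp.single i 1 := fun h => by simp [← h] at hβ
    rw [Finset.sum_eq_single i]
    · simp [h01]
    · intro j _ hj
      rw [if_neg]
      rwa [Finsupp.single_left_inj one_ne_zero]
    · simp
  · rw [Finset.sum_eq_zero, if_neg]
    · by_cases h : coeff β q = 0 <;> simp [h]
    · rintro rfl
      simp at hβ
    · intro i _
      rw [if_neg]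
      rintro rfl
      rw [hs] at hβ
      omega

theorem coeffNorm_eq_sum_of_subset {q : MvPolynomial (Fin n) ℝ} {t : Finset (Fin n →₀ ℕ)}
    (h : q.support ⊆ t) : coeffNorm q = ∑ α ∈ t, |coeff α q| := by
  refine Finset.sum_subset h fun α _ hα => ?_
  rw [notMem_support_iff.1 hα, abs_zero]

theorem single_injective {k : ℕ} (hk : k ≠ 0) :
    Function.Injective fun i : Fin n => Finsupp.single i k :=
  fun _ _ h => (Finsupp.single_left_inj hk).1 h

/-- Only the constant coefficient is discarded, which is harmless because both problems subtract the
value at the origin. -/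
theorem sum_linear_add_sum_higher_le_coeffNorm (q : MvPolynomial (Fin n) ℝ) :
    ∑ i, |coeff (Finsupp.single i 1) q| + ∑ α ∈ q.support with 2 ≤ α.degree, |coeff α q| ≤
      coeffNorm q := by
  classical
  set e : Finset (Fin n →₀ ℕ) := Finset.univ.image fun i => Finsupp.single i 1 with he
  have h1 : ∑ i, |coeff (Finsupp.single i 1) q| = ∑ α ∈ e, |coeff α q| := by
    rw [he, Finset.sum_image fun i _ j _ h => single_injective one_ne_zero h]
  have hdisj : Disjoint e (q.support.filter fun α => 2 ≤ α.degree) := by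
    rw [Finset.disjoint_left]
    intro α hα hα'
    obtain ⟨i, -, rfl⟩ := Finset.mem_image.1 hα
    simp at hα'
  rw [coeffNorm_eq_sum_of_subset (Finset.subset_union_right (s₁ := e)), h1,
    ← Finset.sum_union hdisj]
  refine Finset.sum_le_sum_of_subset_of_nonneg
    (Finset.union_subset_union le_rfl (Finset.filter_subset _ _)) fun _ _ _ => abs_nonneg _

theorem coeff_perturbation (b lam : Fin n → ℝ) (α : Fin n →₀ ℕ) :
    coeff α (perturbation b lam) = ∑ i, (if Finsupp.single i 1 = α then b i else 0) +
      ∑ i, if Finsupp.single i 2 = α then lam i else 0 := by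
  classical
  simp only [perturbation, coeff_add, coeff_sum, coeff_C_mul, coeff_X, coeff_X_pow, mul_ite,
    mul_one, mul_zero]

theorem single_one_ne_single_two (i j : Fin n) :
    (Finsupp.single i 1 : Fin n →₀ ℕ) ≠ Finsupp.single j 2 := fun h => by
  have := congrArg Finsupp.degree h
  simp at this

theorem coeff_single_one_perturbation (b lam : Fin n → ℝ) (i : Fin n) :
    coeff (Finsupp.single i 1) (perturbation b lam) = b i := by
  simp [coeff_perturbation, Finsupp.single_left_inj, (single_one_ne_single_two _ _).symm]

theorem coeff_single_two_perturbation (b lam : Fin n → ℝ) (i : Fin n) :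
    coeff (Finsupp.single i 2) (perturbation b lam) = lam i := by
  simp [coeff_perturbation, Finsupp.single_left_inj, single_one_ne_single_two]

theorem coeffNorm_perturbation (b lam : Fin n → ℝ) (h : ∀ i, 0 ≤ lam i) :
    coeffNorm (perturbation b lam) = sdpCost b lam := by
  classical
  set e₁ : Finset (Fin n →₀ ℕ) := Finset.univ.image fun i => Finsupp.single i 1 with he₁
  set e₂ : Finset (Fin n →₀ ℕ) := Finset.univ.image fun i => Finsupp.single i 2 with he₂
  have hsub : (perturbation b lam).support ⊆ e₁ ∪ e₂ := by
    intro α hα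
    by_contra hn
    simp only [he₁, he₂, Finset.mem_union, Finset.mem_image, Finset.mem_univ, true_and,
      not_or, not_exists] at hn
    rw [mem_support_iff, coeff_perturbation] at hα
    simp [hn.1, hn.2] at hα
  have hdisj : Disjoint e₁ e₂ := by
    rw [Finset.disjoint_left]
    intro α hα hα'
    obtain ⟨i, -, rfl⟩ := Finset.mem_image.1 hα
    obtain ⟨j, -, hj⟩ := Finset.mem_image.1 hα'
    exact single_one_ne_single_two i j hj.symm
  rw [coeffNorm_eq_sum_of_subset hsub, Finset.sum_union hdisj, he₁, he₂,
    Finset.sum_image fun i _ j _ h => single_injective one_ne_zero h,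
    Finset.sum_image fun i _ j _ h => single_injective two_ne_zero h, sdpCost]
  simp only [coeff_single_one_perturbation, coeff_single_two_perturbation]
  simp [abs_of_nonneg, h]

theorem coeffNorm_neg (p : MvPolynomial (Fin n) ℝ) : coeffNorm (-p) = coeffNorm p := by
  simp [coeffNorm, support_neg]

theorem eval_zero_perturbation (b lam : Fin n → ℝ) : eval 0 (perturbation b lam) = 0 := by
  simp [perturbation]

/-- A feasible criterion of the inverse problem yields a feasible point of the small semidefinite
program that costs no more. -/
theorem exists_sdpFeasible_of_inverseFeasible {f h : MvPolynomial (Fin n) ℝ}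
    (hd : f.totalDegree ≤ 2 * d) (hh : h ∈ inverseFeasible f (withBox g) d) :
    ∃ p ∈ sdpFeasible f (withBox g) d, sdpCost p.1 p.2 ≤ coeffNorm (f - h) := by
  set q := f - h with hq
  have hqd : q.totalDegree ≤ f.totalDegree := (totalDegree_sub _ _).trans (max_le le_rfl hh.1)
  obtain ⟨μ, h0, h1, h2⟩ := exists_sum_monomial_add_mem_truncQuadModule (g := g) (d := d)
    (q.support.filter fun α => 2 ≤ α.degree) (fun α hα => (Finset.mem_filter.1 hα).2)
    (fun α hα => (degree_le_totalDegree (Finset.mem_filter.1 hα).1).trans (hqd.trans hd))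
    (fun α => coeff α q)
  refine ⟨⟨fun i => -coeff (Finsupp.single i 1) q, μ⟩, ⟨h0, fun hf => ?_, ?_⟩, ?_⟩
  · have hs : (q.support.filter fun α => 2 ≤ α.degree) = ∅ := by
      rw [Finset.filter_eq_empty_iff]
      intro α hα
      have := degree_le_totalDegree hα
      omega
    rw [hs, Finset.sum_empty, Finset.sum_eq_zero_iff_of_nonneg fun i _ => h0 i] at h1
    ext i
    exact h1 i (Finset.mem_univ i)
  -- Once `b` cancels the linear part of `q`, what remains is `h - h(0)` plus the higher terms of
  -- `q` with their compensating squares.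
  · convert add_mem_truncQuadModule hh.2 h2 using 1
    have hf : f = h + q := by rw [hq]; ring
    have he := eq_constant_add_linear_add_higher q
    simp only [perturbation, hf, map_add, C_neg, neg_mul, Finset.sum_neg_distrib]
    linear_combination he
  · refine le_trans (le_of_eq ?_) (sum_linear_add_sum_higher_le_coeffNorm q)
    simp [sdpCost, h1]

end InvPoly

/-! ### Multipliers at the origin and existence of minimizers -/

namespace InvPoly

open MvPolynomial

variable {n m : ℕ} {J : Type} [Fintype J]

theorem gradZero_add (p q : MvPolynomial (Fin n) ℝ) :
    gradZero (p + q) = gradZero p + gradZero q := by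
  ext i
  simp [gradZero]

theorem gradZero_sum {ι : Type*} (s : Finset ι) (p : ι → MvPolynomial (Fin n) ℝ) :
    gradZero (∑ j ∈ s, p j) = ∑ j ∈ s, gradZero (p j) := by
  ext i
  simp [gradZero]

theorem gradZero_mul (p q : MvPolynomial (Fin n) ℝ) :
    gradZero (p * q) = eval 0 p • gradZero q + eval 0 q • gradZero p := by
  ext i
  simp [gradZero, Derivation.leibniz]

theorem gradZero_perturbation (b lam : Fin n → ℝ) : gradZero (perturbation b lam) = b := by
  classical
  ext i
  simp [gradZero, perturbation, pderiv_X, Pi.single_apply, apply_ite]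

theorem eval_nonneg_of_isSumSq {s : MvPolynomial (Fin n) ℝ} (hs : IsSumSq s) (x : Fin n → ℝ) :
    0 ≤ eval x s := by
  induction hs with
  | zero => simp
  | sq_add a _ ih =>
    rw [map_add, map_mul]
    exact add_nonneg (mul_self_nonneg _) ih

/-- A sum of squares that vanishes at the origin has a critical point there. -/
theorem gradZero_eq_zero_of_isSumSq {s : MvPolynomial (Fin n) ℝ} (hs : IsSumSq s)
    (h0 : eval 0 s = 0) : gradZero s = 0 := by
  induction hs with
  | zero => ext i; simp [gradZero]
  | sq_add a hs ih =>
    have h1 := eval_nonneg_of_isSumSq hs 0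
    rw [map_add, map_mul] at h0
    have h2 := mul_self_nonneg (eval 0 a)
    have ha : eval 0 a = 0 := mul_self_eq_zero.1 (by linarith)
    rw [gradZero_add, gradZero_mul, ih (by linarith), ha]
    simp

/-- The first-order condition at the origin for an element of the quadratic module that vanishes
there. -/
theorem exists_multipliers_of_mem_truncQuadModule {g : J → MvPolynomial (Fin n) ℝ} {d : ℕ}
    (h0 : (0 : Fin n → ℝ) ∈ semialgSet g) {p : MvPolynomial (Fin n) ℝ}
    (hp : p ∈ truncQuadModule g d) (hp0 : eval 0 p = 0) :
    ∃ θ : J → ℝ, (∀ j, 0 ≤ θ j) ∧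
      gradZero p = ∑ j with eval 0 (g j) = 0, θ j • gradZero (g j) := by
  obtain ⟨s, σ, hs, hσ, rfl⟩ := hp
  have hs0 := eval_nonneg_of_isSumSq hs.1 0
  have hσ0 := fun j => eval_nonneg_of_isSumSq (hσ j).1 0
  simp only [map_add, map_sum, map_mul] at hp0
  have hnn : ∀ j ∈ Finset.univ, 0 ≤ eval 0 (σ j) * eval 0 (g j) :=
    fun j _ => mul_nonneg (hσ0 j) (h0 j)
  have hsum := Finset.sum_nonneg hnn
  -- Complementary slackness: all terms of the certificate are nonnegative at the origin and sum to
  -- zero, so each one vanishes there.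
  have hj := (Finset.sum_eq_zero_iff_of_nonneg hnn).1 (by linarith)
  refine ⟨fun j => eval 0 (σ j), hσ0, ?_⟩
  rw [gradZero_add, gradZero_eq_zero_of_isSumSq hs.1 (by linarith), zero_add, gradZero_sum,
    Finset.sum_filter]
  refine Finset.sum_congr rfl fun j hjm => ?_
  rw [gradZero_mul]
  split_ifs with h
  · rw [h, zero_smul, add_zero]
  · have hσj : eval 0 (σ j) = 0 := (mul_eq_zero.1 (hj j hjm)).resolve_right h
    rw [hσj, gradZero_eq_zero_of_isSumSq (hσ j).1 hσj]
    simp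

theorem totalDegree_linear_le (b : Fin n → ℝ) :
    (∑ i, C (b i) * X i : MvPolynomial (Fin n) ℝ).totalDegree ≤ 1 :=
  totalDegree_finsetSum_le fun i _ => (totalDegree_mul _ _).trans (by simp)

theorem totalDegree_perturbation_le (b lam : Fin n → ℝ) :
    (perturbation b lam).totalDegree ≤ 2 := by
  refine (totalDegree_add _ _).trans (max_le ((totalDegree_linear_le b).trans one_le_two) ?_)
  exact totalDegree_finsetSum_le fun i _ => (totalDegree_mul _ _).trans
    (by simp [totalDegree_X_pow])

theorem norm_le_sdpCost {b lam : Fin n → ℝ} (h : ∀ i, 0 ≤ lam i) :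
    ‖(b, lam)‖ ≤ sdpCost b lam := by
  have hb := Finset.sum_nonneg fun i (_ : i ∈ Finset.univ) => abs_nonneg (b i)
  have hl := Finset.sum_nonneg fun i (_ : i ∈ Finset.univ) => h i
  rw [sdpCost]
  refine max_le ((pi_norm_le_iff_of_nonneg (by positivity)).2 fun i => ?_)
    ((pi_norm_le_iff_of_nonneg (by positivity)).2 fun i => ?_)
  · have := Finset.single_le_sum (fun i (_ : i ∈ Finset.univ) => abs_nonneg (b i))
      (Finset.mem_univ i)
    rw [Real.norm_eq_abs]
    linarith
  · have := Finset.single_le_sum (fun i (_ : i ∈ Finset.univ) => h i) (Finset.mem_univ i)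
    rw [Real.norm_of_nonneg (h i)]
    linarith

/-- The feasible set of the small semidefinite program is closed. -/
theorem isClosed_sdpFeasible {f : MvPolynomial (Fin n) ℝ} {g : J → MvPolynomial (Fin n) ℝ} {d : ℕ}
    (hd : f.totalDegree ≤ 2 * d) (hint : (interior (semialgSet g)).Nonempty) :
    IsClosed (sdpFeasible f g d) := by
  -- The bound `2 * d + 2` replaces `2 * d` because the perturbation can have degree two even when
  -- `d = 0`.
  have hdeg : ∀ p : (Fin n → ℝ) × (Fin n → ℝ),
      (f - C (eval 0 f) + perturbation p.1 p.2).totalDegree ≤ 2 * d + 2 := fun p => by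
    have h1 := totalDegree_add (f - C (eval 0 f)) (perturbation p.1 p.2)
    have h2 := totalDegree_perturbation_le p.1 p.2
    have h3 := totalDegree_sub_C_le f (eval 0 f)
    omega
  have hcont : Continuous fun p : (Fin n → ℝ) × (Fin n → ℝ) =>
      coeffMap n (2 * d + 2) (f - C (eval 0 f) + perturbation p.1 p.2) := by
    refine continuous_pi fun α => ?_
    simp only [coeffMap_apply, perturbation, coeff_add, coeff_sum, coeff_C_mul]
    fun_prop
  have heq : sdpFeasible f g d = (⋂ i, {p | 0 ≤ p.2 i}) ∩ ({p | f.totalDegree ≤ 1 → p.2 = 0} ∩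
      (fun p : (Fin n → ℝ) × (Fin n → ℝ) =>
        coeffMap n (2 * d + 2) (f - C (eval 0 f) + perturbation p.1 p.2)) ⁻¹'
        {x | ∃ t : ℝ, 0 ≤ t ∧
          ∃ y ∈ convexHull ℝ (moduleGenerators g d (2 * d + 2)), x = t • y}) := by
    ext p
    rw [Set.mem_inter_iff, Set.mem_inter_iff, Set.mem_preimage,
      ← mem_truncQuadModule_iff (by omega) (hdeg p), Set.mem_iInter]
    rfl
  rw [heq]
  refine (isClosed_iInter fun i => isClosed_le (by fun_prop) (by fun_prop)).inter
    (IsClosed.inter ?_ ((isClosed_coeff_truncQuadModule g (by omega) hint).preimage hcont))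
  by_cases h : f.totalDegree ≤ 1
  · simpa only [h, forall_const] using isClosed_eq continuous_snd continuous_const
  · simp [h]

/-- A continuous function that dominates the norm attains its minimum on a nonempty closed set. -/
theorem exists_isMinOn_of_norm_le {E : Type*} [NormedAddCommGroup E] [ProperSpace E] {F : Set E}
    (hF : IsClosed F) (hne : F.Nonempty) {u : E → ℝ} (hu : Continuous u)
    (hle : ∀ x ∈ F, ‖x‖ ≤ u x) : ∃ x ∈ F, ∀ y ∈ F, u x ≤ u y := by
  obtain ⟨x₀, hx₀⟩ := hne
  -- Outside the ball of radius `u x₀` the values of `u` on `F` already exceed `u x₀`, so minimizing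
  -- inside it suffices.
  obtain ⟨x, hx, hmin⟩ := ((isCompact_closedBall (0 : E) (u x₀)).inter_left hF).exists_isMinOn
    ⟨x₀, hx₀, by simpa using hle x₀ hx₀⟩ hu.continuousOn
  refine ⟨x, hx.1, fun y hy => ?_⟩
  rcases le_or_gt ‖y‖ (u x₀) with h | h
  · exact hmin ⟨hy, by simpa using h⟩
  · exact (hmin ⟨hx₀, by simpa using hle x₀ hx₀⟩).trans (h.le.trans (hle y hy))

theorem exists_isSdpOptimal {f : MvPolynomial (Fin n) ℝ} {g : Fin m → MvPolynomial (Fin n) ℝ}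
    {d : ℕ} (hd : f.totalDegree ≤ 2 * d)
    (hint : (interior (semialgSet (withBox g))).Nonempty) :
    ∃ b lam : Fin n → ℝ, IsSdpOptimal f (withBox g) d b lam := by
  -- The zero criterion is always feasible, and its conversion shows that the small program is
  -- feasible.
  have h0 : (0 : MvPolynomial (Fin n) ℝ) ∈ inverseFeasible f (withBox g) d :=
    ⟨by simp, by simpa using zero_mem_truncQuadModule⟩
  obtain ⟨p₀, hp₀, -⟩ := exists_sdpFeasible_of_inverseFeasible hd h0
  obtain ⟨p, hp, hmin⟩ := exists_isMinOn_of_norm_le (isClosed_sdpFeasible hd hint) ⟨p₀, hp₀⟩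
    (u := fun p => sdpCost p.1 p.2) (by simp only [sdpCost]; fun_prop)
    (fun p hp => norm_le_sdpCost hp.1)
  exact ⟨p.1, p.2, hp, hmin⟩

/-- Feasibility suffices unless `f` is constant. In that case a nonzero `b` would raise the degree,
but comparison with the free point `(0, 0)` forces `b = 0`. -/
theorem IsSdpOptimal.totalDegree_le {f : MvPolynomial (Fin n) ℝ}
    {g : J → MvPolynomial (Fin n) ℝ} {d : ℕ} {b lam : Fin n → ℝ}
    (h : IsSdpOptimal f g d b lam) : (f + perturbation b lam).totalDegree ≤ f.totalDegree := by
  refine (totalDegree_add _ _).trans (max_le le_rfl ?_)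
  rcases Nat.lt_or_ge 1 f.totalDegree with h2 | h2
  · exact (totalDegree_perturbation_le b lam).trans h2
  have hl : lam = 0 := h.1.2.1 h2
  subst hl
  have hp : perturbation b 0 = ∑ i, C (b i) * X i := by simp [perturbation]
  rcases Nat.eq_zero_or_pos f.totalDegree with h1 | h1
  · have hf := totalDegree_eq_zero_iff_eq_C.1 h1
    have hf' : f - C (eval 0 f) = 0 := by
      rw [eval_zero, constantCoeff_eq]
      exact sub_eq_zero.2 hf
    have hcost := h.2 (0, 0) ⟨fun i => le_rfl, fun _ => rfl, by
      have h00 : f - C (eval 0 f) + perturbation (0 : Fin n → ℝ) 0 = 0 := by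
        rw [hf', zero_add]
        simp [perturbation]
      rw [h00]
      exact zero_mem_truncQuadModule⟩
    have hb : ∑ i, |b i| = 0 := by
      refine le_antisymm (by simpa [sdpCost] using hcost) (Finset.sum_nonneg fun i _ => abs_nonneg _)
    rw [Finset.sum_eq_zero_iff_of_nonneg fun i _ => abs_nonneg _] at hb
    have hb' : ∀ i, b i = 0 := fun i => abs_eq_zero.1 (hb i (Finset.mem_univ i))
    simp [hp, hb']
  · exact hp ▸ (totalDegree_linear_le b).trans h1

end InvPoly

/-! ### The main theorem -/

theorem theorem3p4 {n m : ℕ} (f : MvPolynomial (Fin n) ℝ) (g : Fin m → MvPolynomial (Fin n) ℝ)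
    (d : ℕ) (hd : f.totalDegree ≤ 2 * d)
    (h0 : (0 : Fin n → ℝ) ∈ InvPoly.semialgSet (InvPoly.withBox g))
    (hint : (interior (InvPoly.semialgSet (InvPoly.withBox g))).Nonempty) :
    (∃ b lam : Fin n → ℝ, InvPoly.IsSdpOptimal f (InvPoly.withBox g) d b lam) ∧
    ∀ b lam : Fin n → ℝ, InvPoly.IsSdpOptimal f (InvPoly.withBox g) d b lam →
      InvPoly.IsInverseOptimal f (InvPoly.withBox g) d (f + InvPoly.perturbation b lam) ∧
      InvPoly.coeffNorm (f - (f + InvPoly.perturbation b lam)) = InvPoly.sdpCost b lam ∧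
      ∃ θ : Fin m ⊕ Fin n → ℝ, (∀ j, 0 ≤ θ j) ∧
        b = -InvPoly.gradZero f +
          ∑ j with MvPolynomial.eval 0 (InvPoly.withBox g j) = 0,
            θ j • InvPoly.gradZero (InvPoly.withBox g j) := by
  refine ⟨InvPoly.exists_isSdpOptimal hd hint, fun b lam hopt => ?_⟩
  have hnorm : InvPoly.coeffNorm (f - (f + InvPoly.perturbation b lam)) =
      InvPoly.sdpCost b lam := by
    rw [sub_add_cancel_left, InvPoly.coeffNorm_neg, InvPoly.coeffNorm_perturbation b lam hopt.1.1]
  have hmem : f - MvPolynomial.C (MvPolynomial.eval 0 f) + InvPoly.perturbation b lam ∈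
      InvPoly.truncQuadModule (InvPoly.withBox g) d := hopt.1.2.2
  refine ⟨⟨⟨hopt.totalDegree_le, ?_⟩, fun h' hh' => ?_⟩, hnorm, ?_⟩
  · rw [map_add, InvPoly.eval_zero_perturbation, add_zero, add_sub_right_comm]
    exact hmem
  · obtain ⟨p, hp, hle⟩ := InvPoly.exists_sdpFeasible_of_inverseFeasible hd hh'
    rw [hnorm]
    exact (hopt.2 p hp).trans hle
  -- The certified polynomial vanishes at the origin and has gradient `∇f(0) + b` there, so its
  -- first-order condition can be solved for `b`.
  · obtain ⟨θ, hθ, hgrad⟩ := InvPoly.exists_multipliers_of_mem_truncQuadModule h0 hmem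
      (by rw [map_add, InvPoly.eval_zero_perturbation, map_sub, MvPolynomial.eval_C]; ring)
    refine ⟨θ, hθ, ?_⟩
    rw [← hgrad, sub_eq_add_neg, ← MvPolynomial.C_neg, InvPoly.gradZero_add,
      InvPoly.gradZero_add, InvPoly.gradZero_perturbation]
    ext i
    simp [InvPoly.gradZero]
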